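/- Let $\mathcal X\subseteq\mathbb R^d$ be a Borel set and let $X=(X_1,\dots,X_d)$ be a random vector with values in $\mathcal X$ whose law is absolutely continuous with respect to Lebesgue measure on $\mathbb R^d$. A Knothe–Rosenblatt map of $X$ is a map $T_X$ on $\mathcal X$ defined recursively, for $x\in\mathcal X$, by $$[T_X(x)]_1=\mathbb P(X_1\le x_1),\qquad [T_X(x)]_i=\mathbb P\big(X_i\le x_i\,\big|\,[T_X(X)]_{j}=[T_X(x)]_{j}\text{ for all } j<i\big),\quad i=2,\dots,d,$$ where the conditional probabilities are given by regular conditional distributions (Markov kernels) of $X_i$ given $([T_X(X)]_j)_{j<i}$. Such a map exists, and for every choice of these regular conditional distributions the following hold. 1. $T_X$ maps $\mathcal X$ into $[0,1]^d$ and is Borel measurable, and the random vector $T_X(X)$ is uniformly distributed over $[0,1]^d$. 2. $T_X$ is a bijection almost everywhere: there are a Borel set $A\subseteq\mathcal X$ with $\mathbb P(X\in A)=1$ and a Borel set $B\subseteq[0,1]^d$ of full Lebesgue measure in $[0,1]^d$ such that $T_X$ restricts to a bijection from $A$ onto $B$. Moreover, if $T_X^{-1}:\mathbb R^d\to\mathcal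 X$ is any map that agrees on $B$ with the inverse of this bijection, and $U$ is uniformly distributed over $[0,1]^d$ (on any probability space), then $T_X^{-1}(U)$ has the same distribution as $X$. -/

import Mathlib

open MeasureTheory ProbabilityTheory Set

/-- The triangular map `T` built from kernels `κ i` (one for each coordinate `i`):
`T(x)_i = κ_i((T(x)_j)_{j < i}; (-∞, x_i])`, by recursion on the coordinate `i`. -/
noncomputable def triangularCDFMap {d : ℕ} (κ : ∀ i : Fin d, Kernel ({j : Fin d // j < i} → ℝ) ℝ)
    (x : Fin d → ℝ) (i : Fin d) : ℝ :=
  (κ i (fun j => triangularCDFMap κ x j.1)).real (Iic (x i))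
termination_by i.val
decreasing_by exact j.2

/-- `T` is a Knothe–Rosenblatt map of the random vector `X`: its `i`-th coordinate is
`T(x)_i = ℙ(X_i ≤ x_i | T(X)_j = T(x)_j for all j < i)`,
where the conditional probabilities come from a regular conditional distribution `κ i` of `X_i`
given `(T(X)_j)_{j < i}`. Any choice of these (almost surely unique) regular conditional
distributions is allowed. For the first coordinate the condition is empty. -/
def IsKnotheRosenblattMap {Ω : Type*} [MeasurableSpace Ω] {d : ℕ} (P : Measure Ω)
    {S : Set (Fin d → ℝ)} (X : Ω → S) (T : S → Fin d → ℝ) : Prop :=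
  ∃ κ : ∀ i : Fin d, Kernel ({j : Fin d // j < i} → ℝ) ℝ,
    (∀ x : S, T x = triangularCDFMap κ x) ∧
    ∀ i : Fin d, IsMarkovKernel (κ i) ∧
      HasCondDistrib (fun ω => (X ω : Fin d → ℝ) i)
        (fun ω (j : {j : Fin d // j < i}) => T (X ω) j) (κ i) P

/-- The uniform distribution on the unit cube `[0,1]^d`. -/
noncomputable def uniformCube (d : ℕ) : Measure (Fin d → ℝ) := volume.restrict (Icc 0 1)

/-! Absolute continuity forces the conditional laws to be almost surely atomless: `(T(x)_j)_{j < i}`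
is constant along lines in direction `i`, and a probability measure has only countably many atoms,
so by Tonelli the `x` whose `x_i` is an atom form a Lebesgue null set
(`ae_nullSingletonClass_of_hasCondDistrib`). The probability integral transform then makes `T(X)_i`
uniform given the earlier coordinates, hence independent of them (`measure_triangularCDFMap_inter`),
and induction yields the uniform law on the cube.

Two points with the same image are separated only by flat pieces of conditional distribution
functions, and `X` almost surely avoids the right-hand sides of these (`ae_mem_triangularGoodSet`).
On the remaining set `T` is injective, and Lusin–Souslin makes its image Borel and its inverse
measurable there. -/

/-! ### Null sets and one-dimensional distribution functions -/

/-- A measurable set all of whose lines in a fixed coordinate direction are countable is null. -/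
lemma volume_eq_zero_of_countable_slices {ι : Type*} [Fintype ι] [DecidableEq ι]
    {N : Set (ι → ℝ)} (hN : MeasurableSet N) (i : ι)
    (h : ∀ x, {y | Function.update x i y ∈ N}.Countable) : volume N = 0 := by
  have hf : Measurable (N.indicator (1 : (ι → ℝ) → ENNReal)) := measurable_one.indicator hN
  have hz : (fun x : ι → ℝ => ∫⁻ y, N.indicator 1 (Function.update x i y)) = fun _ => (0 : ENNReal) := by
    ext x
    have : ∀ y : ℝ, N.indicator (1 : (ι → ℝ) → ENNReal) (Function.update x i y) =
        {y | Function.update x i y ∈ N}.indicator 1 y := fun y => rfl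
    simp_rw [this]
    rw [lintegral_indicator_one (show MeasurableSet {y | Function.update x i y ∈ N} from
      measurable_update x hN), (h x).measure_zero]
  -- Tonelli with coordinate `i` integrated innermost; the base point `0` is immaterial, as every
  -- coordinate is integrated.
  rw [← lintegral_indicator_one hN, volume_pi, lintegral_eq_lmarginal_univ 0,
    lmarginal_erase' _ hf (Finset.mem_univ i), hz]
  simp [lmarginal]

lemma measurable_kernel_real_Iic {α : Type*} [MeasurableSpace α] (κ : Kernel α ℝ)
    [IsSFiniteKernel κ] : Measurable fun p : α × ℝ => (κ p.1).real (Iic p.2) := by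
  have hs : MeasurableSet {q : (α × ℝ) × ℝ | q.2 ≤ q.1.2} :=
    measurableSet_le measurable_snd (measurable_snd.comp measurable_fst)
  exact (Kernel.measurable_kernel_prodMk_left (κ := κ.comap Prod.fst measurable_fst) hs).ennreal_toReal

lemma measurable_kernel_singleton {α : Type*} [MeasurableSpace α] (κ : Kernel α ℝ)
    [IsSFiniteKernel κ] : Measurable fun p : α × ℝ => κ p.1 {p.2} := by
  have hs : MeasurableSet {q : (α × ℝ) × ℝ | q.2 = q.1.2} :=
    measurableSet_eq_fun measurable_snd (measurable_snd.comp measurable_fst)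
  exact Kernel.measurable_kernel_prodMk_left (κ := κ.comap Prod.fst measurable_fst) hs

/-- The jump of a distribution function at a point is the mass of that point. -/
lemma continuous_real_Iic (ν : Measure ℝ) [IsProbabilityMeasure ν] [NullSingletonClass ν] :
    Continuous fun x => ν.real (Iic x) := by
  have h : ∀ x, ν.real (Iic x) = cdf ν x := fun x => (cdf_eq_real ν x).symm
  simp_rw [h]
  rw [continuous_iff_continuousAt]
  intro x
  rw [(cdf ν).mono.continuousAt_iff_leftLim_eq_rightLim, StieltjesFunction.rightLim_eq]
  have h1 : (cdf ν).measure {x} = 0 := by rw [measure_cdf]; exact measure_singleton x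
  rw [StieltjesFunction.measure_singleton, ENNReal.ofReal_eq_zero] at h1
  exact le_antisymm ((cdf ν).mono.leftLim_le le_rfl) (by linarith)

/-- Probability integral transform. -/
lemma map_real_Iic_eq_uniform (ν : Measure ℝ) [IsProbabilityMeasure ν] [NullSingletonClass ν] :
    ν.map (fun x => ν.real (Iic x)) = volume.restrict (Icc 0 1) := by
  have hc := continuous_real_Iic ν
  have hmono : Monotone fun x => ν.real (Iic x) := fun x y hxy =>
    measureReal_mono (Iic_subset_Iic.2 hxy)
  have hbot : Filter.Tendsto (fun x => ν.real (Iic x)) Filter.atBot (nhds 0) := by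
    exact (tendsto_cdf_atBot ν).congr (cdf_eq_real ν)
  have htop : Filter.Tendsto (fun x => ν.real (Iic x)) Filter.atTop (nhds 1) := by
    exact (tendsto_cdf_atTop ν).congr (cdf_eq_real ν)
  have hprob : IsProbabilityMeasure (ν.map (fun x => ν.real (Iic x))) :=
    Measure.isProbabilityMeasure_map hc.measurable.aemeasurable
  refine Measure.ext_of_Iic _ _ fun c => ?_
  rw [Measure.map_apply hc.measurable measurableSet_Iic, Measure.restrict_apply measurableSet_Iic]
  rcases lt_or_ge c 0 with hc0 | hc0
  · have h1 : (fun x => ν.real (Iic x)) ⁻¹' Iic c = ∅ := by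
      ext x
      simp only [mem_preimage, mem_Iic, mem_empty_iff_false, iff_false, not_le]
      exact hc0.trans_le measureReal_nonneg
    have h2 : Iic c ∩ Icc 0 1 = ∅ := by
      ext x
      simp only [mem_inter_iff, mem_Iic, mem_Icc, mem_empty_iff_false, iff_false]
      intro h; linarith
    simp [h1, h2]
  rcases le_or_gt 1 c with hc1 | hc1
  · have h1 : (fun x => ν.real (Iic x)) ⁻¹' Iic c = univ := by
      ext x
      simp only [mem_preimage, mem_Iic, mem_univ, iff_true]
      exact measureReal_le_one.trans hc1
    have h2 : Iic c ∩ Icc 0 1 = Icc 0 1 :=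
      inter_eq_right.2 fun x hx => hx.2.trans hc1
    simp [h1, h2]
  have h2 : Iic c ∩ Icc 0 1 = Icc 0 c := by
    ext x
    simp only [mem_inter_iff, mem_Iic, mem_Icc]
    constructor
    · rintro ⟨h1, h2, -⟩; exact ⟨h2, h1⟩
    · rintro ⟨h1, h2⟩; exact ⟨h2, h1, h2.trans hc1.le⟩
  rw [h2, Real.volume_Icc, sub_zero]
  -- For `0 < c < 1` the sublevel set is a closed ray, and by the intermediate value theorem the
  -- value `c` is attained at its endpoint.
  have key : ∀ c : ℝ, 0 < c → c < 1 →
      ν ((fun x => ν.real (Iic x)) ⁻¹' Iic c) = ENNReal.ofReal c := by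
    intro c hc0 hc1
    set s := (fun x => ν.real (Iic x)) ⁻¹' Iic c with hs
    obtain ⟨a, ha⟩ := (hbot.eventually_lt_const hc0).exists
    obtain ⟨b, hb⟩ := (htop.eventually_const_lt hc1).exists
    have hsb : BddAbove s := ⟨b, fun x hx => by
      by_contra hbx
      exact absurd (hmono (not_le.1 hbx).le) (not_le.2 (lt_of_le_of_lt hx hb))⟩
    have hmem : sSup s ∈ s := (isClosed_Iic.preimage hc).csSup_mem ⟨a, ha.le⟩ hsb
    have hsI : s = Iic (sSup s) := by
      ext x
      exact ⟨fun hx => le_csSup hsb hx, fun hx => (hmono hx).trans hmem⟩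
    obtain ⟨y, hy⟩ := mem_range_of_exists_le_of_exists_ge hc ⟨a, ha.le⟩ ⟨b, hb.le⟩
    have hy' : y ≤ sSup s := le_csSup hsb (show ν.real (Iic y) ≤ c from hy.le)
    have hval : ν.real (Iic (sSup s)) = c := le_antisymm hmem (hy ▸ hmono hy')
    rw [hsI, ← hval, ofReal_measureReal]
  -- At `c = 0` the sublevel set may be empty and have no endpoint, so `c` is approached from above.
  rcases hc0.eq_or_lt with rfl | hc0
  · rw [ENNReal.ofReal_zero, ← nonpos_iff_eq_zero]
    have ht : Filter.Tendsto (fun c : ℝ => ENNReal.ofReal c) (nhdsWithin 0 (Ioi 0)) (nhds 0) := by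
      simpa using (ENNReal.continuous_ofReal.tendsto 0).mono_left nhdsWithin_le_nhds
    refine ge_of_tendsto ht ?_
    filter_upwards [Ioo_mem_nhdsGT (zero_lt_one' ℝ)] with ε hε
    rw [← key ε hε.1 hε.2]
    exact measure_mono (preimage_mono (Iic_subset_Iic.2 hε.1.le))
  · exact key c hc0 hc1

/-! ### Triangular structure and measurability -/

lemma triangularCDFMap_apply {d : ℕ} (κ : ∀ i : Fin d, Kernel ({j : Fin d // j < i} → ℝ) ℝ)
    (x : Fin d → ℝ) (i : Fin d) :
    triangularCDFMap κ x i = (κ i (fun j => triangularCDFMap κ x j.1)).real (Iic (x i)) := by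
  rw [triangularCDFMap]

/-- The `i`-th coordinate of the triangular map depends only on the first `i` kernels and
coordinates. -/
lemma triangularCDFMap_congr {d : ℕ} {κ κ' : ∀ i : Fin d, Kernel ({j : Fin d // j < i} → ℝ) ℝ}
    {x x' : Fin d → ℝ} (i : Fin d) (hκ : ∀ j ≤ i, κ j = κ' j) (hx : ∀ j ≤ i, x j = x' j) :
    triangularCDFMap κ x i = triangularCDFMap κ' x' i := by
  induction i using WellFoundedLT.induction with
  | ind i ih =>
    rw [triangularCDFMap_apply, triangularCDFMap_apply, hκ i le_rfl, hx i le_rfl]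
    congr 3
    ext j
    exact ih j.1 j.2 (fun k hk => hκ k (hk.trans j.2.le)) (fun k hk => hx k (hk.trans j.2.le))

lemma measurable_triangularCDFMap_apply {d : ℕ}
    (κ : ∀ i : Fin d, Kernel ({j : Fin d // j < i} → ℝ) ℝ) (i : Fin d)
    (hκ : ∀ j ≤ i, IsMarkovKernel (κ j)) : Measurable fun x => triangularCDFMap κ x i := by
  induction i using WellFoundedLT.induction with
  | ind i ih =>
    have := hκ i le_rfl
    simp_rw [triangularCDFMap_apply κ _ i]
    have hm : Measurable fun (x : Fin d → ℝ) (j : {j : Fin d // j < i}) =>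
        triangularCDFMap κ x j.1 :=
      measurable_pi_lambda _ fun j => ih j.1 j.2 fun k hk => hκ k (hk.trans j.2.le)
    exact (measurable_kernel_real_Iic (κ i)).comp (hm.prodMk (measurable_pi_apply i))

lemma measurable_triangularCDFMap {d : ℕ}
    (κ : ∀ i : Fin d, Kernel ({j : Fin d // j < i} → ℝ) ℝ) [hκ : ∀ j, IsMarkovKernel (κ j)] :
    Measurable (triangularCDFMap κ) :=
  measurable_pi_lambda _ fun i => measurable_triangularCDFMap_apply κ i fun j _ => hκ j

lemma triangularCDFMap_mem_Icc {d : ℕ}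
    (κ : ∀ i : Fin d, Kernel ({j : Fin d // j < i} → ℝ) ℝ) [hκ : ∀ j, IsMarkovKernel (κ j)]
    (x : Fin d → ℝ) : triangularCDFMap κ x ∈ Icc (0 : Fin d → ℝ) 1 := by
  constructor <;> intro i <;> rw [triangularCDFMap_apply]
  · exact measureReal_nonneg
  · exact measureReal_le_one

/-! ### Conditional laws and uniformity -/

section

variable {Ω : Type*} [MeasurableSpace Ω] {P : Measure Ω} [IsProbabilityMeasure P] {d : ℕ}
  {X : Ω → Fin d → ℝ}

/-- Kernels giving the conditional distributions for the triangular map exist. -/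
lemma exists_hasCondDistrib_triangularCDFMap (hX : Measurable X) :
    ∃ κ : ∀ i : Fin d, Kernel ({j : Fin d // j < i} → ℝ) ℝ, ∀ i, IsMarkovKernel (κ i) ∧
      HasCondDistrib (fun ω => X ω i)
        (fun ω (j : {j : Fin d // j < i}) => triangularCDFMap κ (X ω) j) (κ i) P := by
  -- The conditioning variable of kernel `k` involves the kernels before it, so they are corrected
  -- one at a time, starting from Dirac placeholders. Replacing kernel `k` leaves the earlier
  -- coordinates unchanged.
  suffices h : ∀ k : ℕ, ∃ κ : ∀ i : Fin d, Kernel ({j : Fin d // j < i} → ℝ) ℝ,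
      ∀ i, IsMarkovKernel (κ i) ∧ (i.1 < k → HasCondDistrib (fun ω => X ω i)
        (fun ω (j : {j : Fin d // j < i}) => triangularCDFMap κ (X ω) j) (κ i) P) by
    obtain ⟨κ, hκ⟩ := h d
    exact ⟨κ, fun i => ⟨(hκ i).1, (hκ i).2 i.2⟩⟩
  intro k
  induction k with
  | zero =>
    exact ⟨fun i => Kernel.const _ (Measure.dirac 0), fun i => ⟨inferInstance, by simp⟩⟩
  | succ k ih =>
    obtain ⟨κ, hκ⟩ := ih
    rcases le_or_gt d k with hk | hk
    · exact ⟨κ, fun i => ⟨(hκ i).1, fun _ => (hκ i).2 (i.2.trans_le hk)⟩⟩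
    have hM : ∀ i, IsMarkovKernel (κ i) := fun i => (hκ i).1
    set m : Fin d := ⟨k, hk⟩
    set κ' := Function.update κ m (condDistrib (fun ω => X ω m)
      (fun ω (j : {j : Fin d // j < m}) => triangularCDFMap κ (X ω) j) P) with hκ'
    have hT : ∀ (x : Fin d → ℝ) (i : Fin d), i < m →
        triangularCDFMap κ' x i = triangularCDFMap κ x i := fun x i hi =>
      triangularCDFMap_congr i (fun j hj => Function.update_of_ne (hj.trans_lt hi).ne _ _)
        fun _ _ => rfl
    refine ⟨κ', fun i => ?_⟩
    rcases eq_or_ne i m with rfl | hi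
    · have hT' : (fun ω (j : {j : Fin d // j < m}) => triangularCDFMap κ' (X ω) j) =
          fun ω (j : {j : Fin d // j < m}) => triangularCDFMap κ (X ω) j := by
        ext ω j
        exact hT _ _ j.2
      have hm : Measurable fun ω (j : {j : Fin d // j < m}) => triangularCDFMap κ (X ω) j :=
        measurable_pi_lambda _ fun j =>
          (measurable_pi_apply j.1).comp ((measurable_triangularCDFMap κ).comp hX)
      have hXm : Measurable fun ω => X ω m := (measurable_pi_apply m).comp hX
      rw [hT', hκ', Function.update_self]
      refine ⟨inferInstance, fun _ => ⟨(hm.prodMk hXm).aemeasurable, ?_⟩⟩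
      exact (compProd_map_condDistrib hXm.aemeasurable).symm
    · have h1 : κ' i = κ i := Function.update_of_ne hi _ _
      rw [h1]
      refine ⟨hM i, fun hik => ?_⟩
      have hlt : i < m := lt_of_le_of_ne (Nat.lt_succ_iff.1 hik) hi
      have hT' : (fun ω (j : {j : Fin d // j < i}) => triangularCDFMap κ' (X ω) j) =
          fun ω (j : {j : Fin d // j < i}) => triangularCDFMap κ (X ω) j := by
        ext ω j
        exact hT _ _ (j.2.trans hlt)
      rw [hT']
      exact (hκ i).2 hlt

variable {κ : ∀ i : Fin d, Kernel ({j : Fin d // j < i} → ℝ) ℝ} [hM : ∀ i, IsMarkovKernel (κ i)]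

/-- If `X` has a density, then almost every conditional distribution is atomless. -/
lemma ae_nullSingletonClass_of_hasCondDistrib (hX : Measurable X) (hac : P.map X ≪ volume)
    (i : Fin d) (hκ : HasCondDistrib (fun ω => X ω i)
      (fun ω (j : {j : Fin d // j < i}) => triangularCDFMap κ (X ω) j) (κ i) P) :
    ∀ᵐ t ∂P.map (fun ω (j : {j : Fin d // j < i}) => triangularCDFMap κ (X ω) j),
      NullSingletonClass (κ i t) := by
  have hR : Measurable fun (x : Fin d → ℝ) (j : {j : Fin d // j < i}) =>
      triangularCDFMap κ x j :=
    measurable_pi_lambda _ fun j => measurable_triangularCDFMap_apply κ j fun k _ => hM k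
  set R := fun (x : Fin d → ℝ) (j : {j : Fin d // j < i}) => triangularCDFMap κ x j with hRdef
  have hs : MeasurableSet {p : ({j : Fin d // j < i} → ℝ) × ℝ | κ i p.1 {p.2} = 0} :=
    measurable_kernel_singleton (κ i) (measurableSet_singleton 0)
  have hN : MeasurableSet {x : Fin d → ℝ | κ i (R x) {x i} = 0} :=
    (hR.prodMk (measurable_pi_apply i)) hs
  have hvol : volume {x : Fin d → ℝ | κ i (R x) {x i} = 0}ᶜ = 0 := by
    refine volume_eq_zero_of_countable_slices hN.compl i fun x => ?_
    have hRu : ∀ y, R (Function.update x i y) = R x := fun y => by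
      ext j
      exact triangularCDFMap_congr j.1 (fun _ _ => rfl) fun k hk =>
        Function.update_of_ne (hk.trans_lt j.2).ne _ _
    simp only [mem_compl_iff, mem_ofPred_eq, hRu, Function.update_self]
    -- The slice is the set of atoms of one fixed finite measure.
    exact Measure.countable_meas_pos_of_disjoint_iUnion (μ := κ i (R x))
      (fun y => measurableSet_singleton y)
      (fun a b hab => by simpa using hab) |>.mono fun y hy => pos_iff_ne_zero.2 hy
  have hae : ∀ᵐ ω ∂P, κ i (R (X ω)) {X ω i} = 0 :=
    ae_of_ae_map hX.aemeasurable (hac hvol)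
  have hae2 : ∀ᵐ p ∂((P.map fun ω => R (X ω)) ⊗ₘ κ i), κ i p.1 {p.2} = 0 := by
    rw [← hκ.map_eq]
    exact (ae_map_iff hκ.aemeasurable hs).2 hae
  filter_upwards [Measure.ae_ae_of_ae_compProd hae2] with t ht
  refine ⟨fun y => ?_⟩
  -- An atom would lie in the set of all atoms, which `ht` shows to be null.
  by_contra hy
  have h0 : κ i t {y | ¬ κ i t {y} = 0} = 0 := ht
  exact hy (measure_mono_null (singleton_subset_iff.2 hy) h0)

/-- The conditional law of `T(X)_i` given the previous coordinates is uniform on `[0,1]`. -/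
lemma measure_triangularCDFMap_inter (hX : Measurable X) (hac : P.map X ≪ volume)
    (i : Fin d) (hκ : HasCondDistrib (fun ω => X ω i)
      (fun ω (j : {j : Fin d // j < i}) => triangularCDFMap κ (X ω) j) (κ i) P)
    {r : Set ({j : Fin d // j < i} → ℝ)} (hr : MeasurableSet r) {s : Set ℝ}
    (hs : MeasurableSet s) :
    P ({ω | (fun j : {j : Fin d // j < i} => triangularCDFMap κ (X ω) j) ∈ r} ∩
        {ω | triangularCDFMap κ (X ω) i ∈ s}) =
      P {ω | (fun j : {j : Fin d // j < i} => triangularCDFMap κ (X ω) j) ∈ r} *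
        volume.restrict (Icc 0 1) s := by
  have hR : Measurable fun ω (j : {j : Fin d // j < i}) => triangularCDFMap κ (X ω) j :=
    measurable_pi_lambda _ fun j =>
      (measurable_triangularCDFMap_apply κ j fun k _ => hM k).comp hX
  have hF := measurable_kernel_real_Iic (κ i)
  have hset : MeasurableSet {p : ({j : Fin d // j < i} → ℝ) × ℝ |
      p.1 ∈ r ∧ (κ i p.1).real (Iic p.2) ∈ s} := (measurable_fst hr).inter (hF hs)
  have h1 := hκ.measure_eq hset
  have h2 : {ω | (fun j : {j : Fin d // j < i} => triangularCDFMap κ (X ω) j) ∈ r} ∩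
        {ω | triangularCDFMap κ (X ω) i ∈ s} =
      {ω | (fun j : {j : Fin d // j < i} => triangularCDFMap κ (X ω) j) ∈ r ∧
        (κ i (fun j : {j : Fin d // j < i} => triangularCDFMap κ (X ω) j)).real (Iic (X ω i))
          ∈ s} := by
    ext ω
    simp only [mem_inter_iff, mem_ofPred_eq, triangularCDFMap_apply κ _ i]
  rw [h2]
  refine h1.trans ?_
  rw [Measure.compProd_apply hset]
  have h3 : ∀ᵐ t ∂P.map (fun ω (j : {j : Fin d // j < i}) => triangularCDFMap κ (X ω) j),
      κ i t (Prod.mk t ⁻¹' {p : ({j : Fin d // j < i} → ℝ) × ℝ |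
        p.1 ∈ r ∧ (κ i p.1).real (Iic p.2) ∈ s}) =
      r.indicator (fun _ => volume.restrict (Icc 0 1) s) t := by
    filter_upwards [ae_nullSingletonClass_of_hasCondDistrib hX hac i hκ] with t ht
    by_cases htr : t ∈ r
    · rw [indicator_of_mem htr, ← map_real_Iic_eq_uniform (κ i t),
        Measure.map_apply (show Measurable fun y => (κ i t).real (Iic y) from
          hF.comp measurable_prodMk_left) hs]
      congr 1
      ext y
      simp [htr]
    · rw [indicator_of_notMem htr]
      simp [htr]
  rw [lintegral_congr_ae h3, lintegral_indicator_const hr, Measure.map_apply hR hr, mul_comm]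
  rfl

/-- `T(X)` is uniform on the cube. -/
lemma hasLaw_triangularCDFMap (hX : Measurable X) (hac : P.map X ≪ volume)
    (hκ : ∀ i, HasCondDistrib (fun ω => X ω i)
      (fun ω (j : {j : Fin d // j < i}) => triangularCDFMap κ (X ω) j) (κ i) P) :
    HasLaw (fun ω => triangularCDFMap κ (X ω)) (uniformCube d) P := by
  have hT : Measurable fun ω => triangularCDFMap κ (X ω) := (measurable_triangularCDFMap κ).comp hX
  refine ⟨hT.aemeasurable, ?_⟩
  have hpi : uniformCube d = Measure.pi fun _ : Fin d => (volume : Measure ℝ).restrict (Icc 0 1) := by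
    rw [uniformCube, volume_pi, ← Measure.restrict_pi_pi, ← pi_univ_Icc]
    rfl
  rw [hpi]
  refine (Measure.pi_eq fun s hs => ?_).symm
  -- The first `k` coordinates are treated jointly; each new one contributes an independent factor.
  have key : ∀ k ≤ d, P {ω | ∀ i : Fin d, i.1 < k → triangularCDFMap κ (X ω) i ∈ s i} =
      ∏ i : Fin d with i.1 < k, (volume : Measure ℝ).restrict (Icc 0 1) (s i) := by
    intro k hk
    induction k with
    | zero => simp
    | succ k ih =>
      set m : Fin d := ⟨k, hk⟩ with hm
      have hr : MeasurableSet {t : {j : Fin d // j < m} → ℝ | ∀ j, t j ∈ s j.1} := by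
        simp only [ofPred_forall]
        exact MeasurableSet.iInter fun j => measurable_pi_apply j (hs j.1)
      have h := measure_triangularCDFMap_inter hX hac m (hκ m) hr (hs m)
      have h1 : {ω | (fun j : {j : Fin d // j < m} => triangularCDFMap κ (X ω) j) ∈
          {t : {j : Fin d // j < m} → ℝ | ∀ j, t j ∈ s j.1}} =
          {ω | ∀ i : Fin d, i.1 < k → triangularCDFMap κ (X ω) i ∈ s i} := by
        ext ω
        exact ⟨fun h i hi => h ⟨i, hi⟩, fun h j => h j.1 j.2⟩
      have h2 : {ω | ∀ i : Fin d, i.1 < k + 1 → triangularCDFMap κ (X ω) i ∈ s i} =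
          {ω | ∀ i : Fin d, i.1 < k → triangularCDFMap κ (X ω) i ∈ s i} ∩
            {ω | triangularCDFMap κ (X ω) m ∈ s m} := by
        ext ω
        refine ⟨fun h => ⟨fun i hi => h i (hi.trans k.lt_succ_self), h m k.lt_succ_self⟩,
          fun h i hi => ?_⟩
        rcases (Nat.lt_succ_iff.1 hi).lt_or_eq with hi | hi
        · exact h.1 i hi
        · obtain rfl : i = m := Fin.ext hi
          exact h.2
      have h3 : (Finset.univ.filter fun i : Fin d => i.1 < k + 1) =
          insert m (Finset.univ.filter fun i : Fin d => i.1 < k) := by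
        ext i
        simp only [Finset.mem_filter, Finset.mem_univ, true_and, Finset.mem_insert, Fin.ext_iff, hm]
        omega
      rw [h1] at h
      rw [h2, h, ih (Nat.le_of_succ_le hk), h3, Finset.prod_insert (by simp [hm]), mul_comm]
  rw [Measure.map_apply hT (MeasurableSet.univ_pi hs)]
  have h := key d le_rfl
  simpa [preimage, mem_univ_pi, Set.mem_pi] using h

/-! ### Almost sure injectivity -/

/-- The points at which no conditional distribution function used by the triangular map has a flat
piece to the left. -/
def triangularGoodSet (κ : ∀ i : Fin d, Kernel ({j : Fin d // j < i} → ℝ) ℝ) :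
    Set (Fin d → ℝ) :=
  {x | ∀ i, ∀ q : ℚ, (q : ℝ) < x i →
    (κ i fun j => triangularCDFMap κ x j).real (Iic (q : ℝ)) ≠ triangularCDFMap κ x i}

/-- Equal images mean equal conditioning values, hence the same distribution function in each
coordinate. If `x i < y i`, it is constant between them, in particular at a rational, which goodness
of `y` forbids. -/
lemma injOn_triangularCDFMap : InjOn (triangularCDFMap κ) (triangularGoodSet κ) := by
  have aux : ∀ x ∈ triangularGoodSet κ, ∀ y ∈ triangularGoodSet κ,
      triangularCDFMap κ x = triangularCDFMap κ y → ∀ i, y i ≤ x i := by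
    intro x hx y hy hxy i
    by_contra! hlt
    obtain ⟨q, hxq, hqy⟩ := exists_rat_btwn hlt
    refine hy i q hqy (le_antisymm ?_ ?_)
    · rw [triangularCDFMap_apply κ y i]
      exact measureReal_mono (Iic_subset_Iic.2 hqy.le)
    · rw [← hxy, triangularCDFMap_apply κ x i]
      exact measureReal_mono (Iic_subset_Iic.2 hxq.le)
  intro x hx y hy hxy
  ext i
  exact le_antisymm (aux y hy x hx hxy.symm i) (aux x hx y hy hxy i)

lemma measurableSet_triangularGoodSet : MeasurableSet (triangularGoodSet κ) := by
  simp only [triangularGoodSet, ofPred_forall]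
  refine MeasurableSet.iInter fun i => MeasurableSet.iInter fun q => ?_
  have hR : Measurable fun (x : Fin d → ℝ) (j : {j : Fin d // j < i}) =>
      triangularCDFMap κ x j :=
    measurable_pi_lambda _ fun j => measurable_triangularCDFMap_apply κ j fun k _ => hM k
  have h1 : MeasurableSet {x : Fin d → ℝ | (q : ℝ) < x i} :=
    measurableSet_lt measurable_const (measurable_pi_apply i)
  have h2 : MeasurableSet {x : Fin d → ℝ |
      (κ i fun j => triangularCDFMap κ x j).real (Iic (q : ℝ)) = triangularCDFMap κ x i} :=
    measurableSet_eq_fun ((measurable_kernel_real_Iic (κ i)).comp (hR.prodMk measurable_const))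
      (measurable_triangularCDFMap_apply κ i fun k _ => hM k)
  convert h1.compl.union h2.compl using 1
  ext x
  simp [imp_iff_not_or]

/-- Given the past, the transformed coordinate is uniform, so it almost surely misses the single
value at `q`; only countably many pairs `(i, q)` occur. -/
lemma ae_mem_triangularGoodSet (hX : Measurable X) (hac : P.map X ≪ volume)
    (hκ : ∀ i, HasCondDistrib (fun ω => X ω i)
      (fun ω (j : {j : Fin d // j < i}) => triangularCDFMap κ (X ω) j) (κ i) P) :
    ∀ᵐ ω ∂P, X ω ∈ triangularGoodSet κ := by
  simp only [triangularGoodSet, mem_ofPred_eq]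
  refine ae_all_iff.2 fun i => ae_all_iff.2 fun q => ?_
  have hF := measurable_kernel_real_Iic (κ i)
  have hs : MeasurableSet {p : ({j : Fin d // j < i} → ℝ) × ℝ |
      (κ i p.1).real (Iic (q : ℝ)) ≠ (κ i p.1).real (Iic p.2)} :=
    (measurableSet_eq_fun (hF.comp (measurable_fst.prodMk measurable_const)) hF).compl
  have h1 : ∀ᵐ p ∂((P.map fun ω (j : {j : Fin d // j < i}) => triangularCDFMap κ (X ω) j) ⊗ₘ κ i),
      (κ i p.1).real (Iic (q : ℝ)) ≠ (κ i p.1).real (Iic p.2) := by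
    refine Measure.ae_compProd_of_ae_ae hs ?_
    filter_upwards [ae_nullSingletonClass_of_hasCondDistrib hX hac i (hκ i)] with t ht
    have hFt : Measurable fun y => (κ i t).real (Iic y) := hF.comp measurable_prodMk_left
    have h0 : (κ i t).map (fun y => (κ i t).real (Iic y)) {(κ i t).real (Iic (q : ℝ))} = 0 := by
      rw [map_real_Iic_eq_uniform]
      exact measure_singleton _
    rw [Measure.map_apply hFt (measurableSet_singleton _)] at h0
    filter_upwards [measure_eq_zero_iff_ae_notMem.1 h0] with y hy hy'
    exact hy hy'.symm
  rw [← (hκ i).map_eq, ae_map_iff (hκ i).aemeasurable hs] at h1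
  filter_upwards [h1] with ω hω _
  rwa [triangularCDFMap_apply κ _ i]

end

/-! ### Inversion and the main theorem -/

/-- A measurable map `T` on a standard Borel space that is injective on a set of full measure for
the law of `X` is a bijection from that set to a set of full measure for the law of `T(X)`, and its
inverse transports the law of `T(X)` back to the law of `X`. -/
lemma identDistrib_inverse_of_bijOn {Ω Ω' α β : Type*} [MeasurableSpace Ω] [MeasurableSpace Ω']
    [MeasurableSpace α] [StandardBorelSpace α] [MeasurableSpace β]
    [MeasurableSpace.CountablySeparated β] {P : Measure Ω} {P' : Measure Ω'} {X : Ω → α}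
    (hX : Measurable X) {T : α → β} (hT : Measurable T) {A : Set α} (hA : MeasurableSet A)
    (hXA : ∀ᵐ ω ∂P, X ω ∈ A) {B : Set β} (hB : BijOn T A B) (hBm : MeasurableSet B)
    {S : β → α} (hS : InvOn S T A B) {U : Ω' → β}
    (hU : IdentDistrib U (fun ω => T (X ω)) P' P) :
    IdentDistrib (fun ω' => S (U ω')) X P' P := by
  have hSB : Measurable (B.domRestrict S) := by
    intro E hE
    have h : B.domRestrict S ⁻¹' E = Subtype.val ⁻¹' (T '' (A ∩ E)) := by
      ext ⟨b, hb⟩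
      obtain ⟨a, ha, rfl⟩ := hB.surjOn hb
      change S (T a) ∈ E ↔ T a ∈ T '' (A ∩ E)
      rw [hS.1 ha]
      refine ⟨fun h => ⟨a, ⟨ha, h⟩, rfl⟩, ?_⟩
      rintro ⟨a', ha', h⟩
      rw [← hB.injOn ha'.1 ha h]
      exact ha'.2
    -- Lusin–Souslin: injective Borel images of Borel sets are Borel.
    rw [h]
    exact measurable_subtype_coe
      ((hA.inter hE).image_of_measurable_injOn hT (hB.injOn.mono inter_subset_left))
  have hTB : ∀ᵐ ω ∂P, T (X ω) ∈ B := hXA.mono fun ω h => hB.mapsTo h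
  have hUB : ∀ᵐ b ∂P'.map U, b ∈ B := by
    rw [hU.map_eq]
    exact (ae_map_iff (hT.comp hX).aemeasurable hBm).2 hTB
  -- `S` is arbitrary off `B`, so only almost everywhere measurability is available.
  have hSU : AEMeasurable S (P'.map U) := by
    rw [← Measure.restrict_eq_self_of_ae_mem hUB]
    exact aemeasurable_restrict_of_measurable_subtype hBm hSB
  have hSTX : (fun ω => S (T (X ω))) =ᵐ[P] X := hXA.mono fun ω h => hS.1 h
  refine ⟨hSU.comp_aemeasurable hU.aemeasurable_fst, hX.aemeasurable, ?_⟩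
  have h1 : P'.map (fun ω' => S (U ω')) = (P'.map U).map S :=
    (AEMeasurable.map_map_of_aemeasurable hSU hU.aemeasurable_fst).symm
  have h2 : P.map (fun ω => S (T (X ω))) = (P.map fun ω => T (X ω)).map S :=
    (AEMeasurable.map_map_of_aemeasurable (hU.map_eq ▸ hSU) hU.aemeasurable_snd).symm
  rw [h1, hU.map_eq, ← h2, Measure.map_congr hSTX]

theorem mainTheorem4 {Ω : Type*} [MeasurableSpace Ω] (P : Measure Ω) [IsProbabilityMeasure P]
    {d : ℕ} (S : Set (Fin d → ℝ)) (hS : MeasurableSet S)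
    (X : Ω → S) (hX : Measurable X)
    (hac : P.map (fun ω => (X ω : Fin d → ℝ)) ≪ volume) :
    (∃ T : S → Fin d → ℝ, IsKnotheRosenblattMap P X T) ∧
    ∀ T : S → Fin d → ℝ, IsKnotheRosenblattMap P X T →
      -- `T` maps into the unit cube, is Borel measurable, and `T(X)` is uniform
      ((∀ x, T x ∈ Icc (0 : Fin d → ℝ) 1) ∧ Measurable T ∧
        HasLaw (fun ω => T (X ω)) (uniformCube d) P) ∧
      -- `T` is a bijection almost everywhere, and its inverse maps a uniform vector to a copy of `X`
      ∃ (A : Set S) (B : Set (Fin d → ℝ)),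
        MeasurableSet A ∧ (∀ᵐ ω ∂P, X ω ∈ A) ∧
        MeasurableSet B ∧ B ⊆ Icc 0 1 ∧ volume (Icc (0 : Fin d → ℝ) 1 \ B) = 0 ∧
        BijOn T A B ∧
        ∀ Tinv : (Fin d → ℝ) → S, InvOn Tinv T A B →
          ∀ (Ω' : Type*) [MeasurableSpace Ω'] (P' : Measure Ω') [IsProbabilityMeasure P']
            (U : Ω' → Fin d → ℝ), HasLaw U (uniformCube d) P' →
            IdentDistrib (fun ω' => Tinv (U ω')) X P' P := by
  have hX' : Measurable fun ω => (X ω : Fin d → ℝ) := measurable_subtype_coe.comp hX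
  have : StandardBorelSpace S := hS.standardBorel
  constructor
  · obtain ⟨κ, hκ⟩ := exists_hasCondDistrib_triangularCDFMap (P := P) hX'
    exact ⟨fun x => triangularCDFMap κ x, κ, fun _ => rfl, hκ⟩
  rintro T ⟨κ, hTκ, hκ⟩
  obtain rfl : T = fun x : S => triangularCDFMap κ x := funext hTκ
  have hM : ∀ i, IsMarkovKernel (κ i) := fun i => (hκ i).1
  have hcd : ∀ i, HasCondDistrib (fun ω => (X ω : Fin d → ℝ) i)
      (fun ω (j : {j : Fin d // j < i}) => triangularCDFMap κ (X ω) j) (κ i) P :=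
    fun i => (hκ i).2
  have hT : Measurable fun x : S => triangularCDFMap κ x :=
    (measurable_triangularCDFMap κ).comp measurable_subtype_coe
  have hlaw : HasLaw (fun ω => triangularCDFMap κ (X ω)) (uniformCube d) P :=
    hasLaw_triangularCDFMap hX' hac hcd
  refine ⟨⟨fun x => triangularCDFMap_mem_Icc κ x, hT, hlaw⟩, ?_⟩
  have hA : MeasurableSet {x : S | (x : Fin d → ℝ) ∈ triangularGoodSet κ} :=
    measurable_subtype_coe measurableSet_triangularGoodSet
  have hXA : ∀ᵐ ω ∂P, X ω ∈ {x : S | (x : Fin d → ℝ) ∈ triangularGoodSet κ} :=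
    ae_mem_triangularGoodSet hX' hac hcd
  have hinj : InjOn (fun x : S => triangularCDFMap κ x)
      {x : S | (x : Fin d → ℝ) ∈ triangularGoodSet κ} :=
    fun x hx y hy hxy => Subtype.ext (injOn_triangularCDFMap hx hy hxy)
  have hBm := hA.image_of_measurable_injOn hT hinj
  refine ⟨_, _, hA, hXA, hBm, ?_, ?_, hinj.bijOn_image, ?_⟩
  · rintro _ ⟨x, -, rfl⟩
    exact triangularCDFMap_mem_Icc κ x
  -- The image has full volume because `T(X)` is uniform and almost surely lies in it.
  · have h : ∀ᵐ u ∂uniformCube d, u ∈ (fun x : S => triangularCDFMap κ x) ''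
        {x : S | (x : Fin d → ℝ) ∈ triangularGoodSet κ} := by
      rw [← hlaw.map_eq]
      refine (ae_map_iff hlaw.aemeasurable hBm).2 ?_
      exact hXA.mono fun ω h => mem_image_of_mem _ h
    rw [uniformCube, ae_restrict_iff' measurableSet_Icc] at h
    refine measure_mono_null ?_ (ae_iff.1 h)
    rintro u ⟨hu, hu'⟩ h
    exact hu' (h hu)
  · intro Tinv hTinv Ω' _ P' _ U hU
    exact identDistrib_inverse_of_bijOn hX hT hA hXA hinj.bijOn_image hBm hTinv
      ⟨hU.aemeasurable, hlaw.aemeasurable, hU.map_eq.trans hlaw.map_eq.symm⟩
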